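/- **Setting.** Let $r>4$ and let $V_i\in C^r(D_i)$ ($i=1,2$), where $D_i\ni 0$ is an open interval (possibly $\mathbb R$), with $V_i(0)=0$ and $q\,V_i'(q)>0$ for $0\neq q\in D_i$. Let $V_c\in C^r(D_1\times D_2)$ have bounded derivatives of orders $0,\dots,r$, and let $q_i^w\in D_i$, $q_i^w<0$. Consider the flow of $$H(q,p;\varepsilon)=\tfrac{p_1^2}{2}+V_1(q_1)+\tfrac{p_2^2}{2}+V_2(q_2)+\varepsilon V_c(q_1,q_2)$$ outside the step $\{q_1<q_1^w,\ q_2<q_2^w\}$, with elastic reflections $p_1\mapsto -p_1$ at the right wall $q_1=q_1^w$, $q_2<q_2^w$ and $p_2\mapsto -p_2$ at the upper wall $q_2=q_2^w$, $q_1<q_1^w$; trajectories that hit the corner $(q_1^w,q_2^w)$ stop there. Fix an energy $h>V_1(q_1^w)+V_2(q_2^w)$ such that each $V_i$ takes values larger than $h$ on both sides of $0$ (so the unperturbed motions of partial energy at most $h$ are oscillations). Let $\Sigma_h=\{p_1=0,\ \dot p_1<0,\ H=h\}$, and let $(\theta,I)$, $\theta\in\mathbb R/2\pi\mathbb Z$,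 be the angle and action of the unperturbed oscillator $H_2=p_2^2/2+V_2(q_2)$: $I$ is the area enclosed by the level curve of $H_2$ divided by $2\pi$, and $\theta$ is $2\pi$ times the time elapsed since the maximum of $q_2$ divided by the period. Let $I_{\max}$ be the action at energy $H_2=h$, and let $\mathcal F_\varepsilon$ be the first return map to $\Sigma_h$ in the coordinates $(\theta,I)$; it is a partial map, undefined where the trajectory does not return. The tangential curve is the set of initial conditions on $\Sigma_h$ whose trajectory touches the line $q_1=q_1^w$ tangentially before its first return to $\Sigma_h$; it is written as a graph $I=I^\varepsilon_{tan}(\theta)$. The normal coordinates are $(\phi,K)=S(\theta,I)=(\theta,\,I-I^\varepsilon_{tan}(\theta))$. Put $$\varepsilon f(\phi)=\varepsilon f(\phi;\varepsilon):=I^\varepsilon_{tan}(-\phi)-I^\varepsilon_{tan}(\phi),\qquad \mathcal R_\varepsilon(\phi,K):=(-\phi,\ K-\varepsilon f(\phi)).$$ **Theorem 3.3.** For all $0<a<b<I_{\max}$ there is $\varepsilon_c>0$ such that for all $|\varepsilon|<\varepsilon_c$: the function $\varepsilon f(\cdot\,;\varepsilon)$ is odd; the relation "the first return to $\Sigma_h$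 of the point with coordinates $(\theta,I)$ has coordinates $(\bar\theta,\bar I)$", for $I,\bar I\in(a,b)$, is the graph of an injective partial map $\mathcal F_\varepsilon$; and in the normal coordinates this map, $S\mathcal F_\varepsilon S^{-1}$, again denoted $\mathcal F_\varepsilon$, has the time-reversal symmetry $$\mathcal R_\varepsilon\,\mathcal F_\varepsilon(\phi,K)=\mathcal F_\varepsilon^{-1}\,\mathcal R_\varepsilon(\phi,K),$$ as an identity of partial maps: for every $(\phi,K)$, one side is defined if and only if the other is, and then they are equal. -/

import Mathlib

open Set

noncomputable section

/-- The mechanical data of an oscillators-step system of class `C^r`. The potential `Vᵢ` of the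
`i`-th oscillator lives on an open interval `Dᵢ` around `0` (possibly all of `ℝ`), and the step is
the open quadrant `{q₁ < q₁w, q₂ < q₂w}`. -/
structure StepSystem (r : ℕ) where
  D₁ : Set ℝ
  D₂ : Set ℝ
  isOpen_D₁ : IsOpen D₁
  isOpen_D₂ : IsOpen D₂
  ordConnected_D₁ : D₁.OrdConnected
  ordConnected_D₂ : D₂.OrdConnected
  zero_mem_D₁ : (0 : ℝ) ∈ D₁
  zero_mem_D₂ : (0 : ℝ) ∈ D₂
  /-- potential of the horizontal oscillator -/
  V₁ : ℝ → ℝ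
  /-- potential of the vertical oscillator -/
  V₂ : ℝ → ℝ
  contDiffOn_V₁ : ContDiffOn ℝ r V₁ D₁
  contDiffOn_V₂ : ContDiffOn ℝ r V₂ D₂
  V₁_zero : V₁ 0 = 0
  V₂_zero : V₂ 0 = 0
  V₁_convex : ∀ q ∈ D₁, q ≠ 0 → 0 < q * deriv V₁ q
  V₂_convex : ∀ q ∈ D₂, q ≠ 0 → 0 < q * deriv V₂ q
  /-- coupling potential -/
  Vc : ℝ × ℝ → ℝ
  contDiffOn_Vc : ContDiffOn ℝ r Vc (D₁ ×ˢ D₂)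
  bounded_Vc : ∀ k ≤ r, ∃ C : ℝ, ∀ q ∈ D₁ ×ˢ D₂, ‖iteratedFDeriv ℝ k Vc q‖ ≤ C
  /-- position of the right wall of the step -/
  q₁w : ℝ
  /-- position of the upper wall of the step -/
  q₂w : ℝ
  q₁w_mem : q₁w ∈ D₁
  q₂w_mem : q₂w ∈ D₂
  q₁w_neg : q₁w < 0
  q₂w_neg : q₂w < 0

/-- `h` lies below the escape energy of the potential `V` on both sides of its minimum, i.e. the
one-dimensional motions of energy at most `h` in the potential `V` are oscillations. -/
def Confines (D : Set ℝ) (V : ℝ → ℝ) (h : ℝ) : Prop :=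
  (∃ q ∈ D, q < 0 ∧ h < V q) ∧ ∃ q ∈ D, 0 < q ∧ h < V q

/-- Phase points `((q₁, q₂), (p₁, p₂))`. -/
abbrev Phase := (ℝ × ℝ) × (ℝ × ℝ)

/-- The cylinder on which the coordinates `(θ, I)` and `(φ, K)` take their values; the angles are
taken modulo `2π`. -/
abbrev Cylinder := Real.Angle × ℝ

namespace StepSystem

variable {r : ℕ} (M : StepSystem r)

/-! ### Hamiltonian, vector field, impacts -/

/-- The perturbed Hamiltonian `H(·; ε)`. -/
def energy (ε : ℝ) (z : Phase) : ℝ :=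
  z.2.1 ^ 2 / 2 + M.V₁ z.1.1 + z.2.2 ^ 2 / 2 + M.V₂ z.1.2 + ε * M.Vc z.1

/-- The right-hand side of `dp₁/dt = -∂H/∂q₁`. -/
def force₁ (ε : ℝ) (q : ℝ × ℝ) : ℝ :=
  -deriv M.V₁ q.1 - ε * fderiv ℝ M.Vc q (1, 0)

/-- The right-hand side of `dp₂/dt = -∂H/∂q₂`. -/
def force₂ (ε : ℝ) (q : ℝ × ℝ) : ℝ :=
  -deriv M.V₂ q.2 - ε * fderiv ℝ M.Vc q (0, 1)

/-- The Hamiltonian vector field of `H(·; ε)`. -/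
def vectorField (ε : ℝ) (z : Phase) : Phase :=
  (z.2, (M.force₁ ε z.1, M.force₂ ε z.1))

/-- The open step in the configuration plane. -/
def step : Set (ℝ × ℝ) := {q | q.1 < M.q₁w ∧ q.2 < M.q₂w}

/-- The corner point of the step. -/
def corner : ℝ × ℝ := (M.q₁w, M.q₂w)

/-- Configurations allowed to the particle: those outside the open step. -/
def config : Set (ℝ × ℝ) := (M.D₁ ×ˢ M.D₂) \ M.step

/-- Elastic reflection: the state `z'` just after the impact as a function of the state `z` just
before it, at the right wall or at the upper wall of the step. -/
def Impact (z z' : Phase) : Prop :=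
  (z.1.1 = M.q₁w ∧ z.1.2 < M.q₂w ∧ z.2.1 < 0 ∧ z' = (z.1, (-z.2.1, z.2.2))) ∨
  (z.1.2 = M.q₂w ∧ z.1.1 < M.q₁w ∧ z.2.2 < 0 ∧ z' = (z.1, (z.2.1, -z.2.2)))

/-- `w` is reached from `z` in positive time along an orbit of the smooth Hamiltonian flow which
stays outside the open step and which, strictly between its end points, meets neither the corner
nor the set `Sec`. Tangential contacts with the walls are allowed. -/
def FreeArc (ε : ℝ) (Sec : Set Phase) (z w : Phase) : Prop :=
  ∃ (τ : ℝ) (γ : ℝ → Phase), 0 < τ ∧ γ 0 = z ∧ γ τ = w ∧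
    (∀ t ∈ Icc 0 τ, (γ t).1 ∈ M.config ∧
      HasDerivWithinAt γ (M.vectorField ε (γ t)) (Icc 0 τ) t) ∧
    ∀ t ∈ Ioo 0 τ, (γ t).1 ≠ M.corner ∧ γ t ∉ Sec

/-- `w` is reached from `z` in positive time along a trajectory of the impact system (smooth arcs
joined by elastic reflections) which meets neither the corner nor the set `Sec` strictly between
its end points. In particular a trajectory is not continued past the corner. -/
inductive Reach (ε : ℝ) (Sec : Set Phase) : Phase → Phase → Prop
  | arc {z w : Phase} : M.FreeArc ε Sec z w → Reach ε Sec z w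
  | impact {z a b w : Phase} : M.FreeArc ε Sec z a → a ∉ Sec → M.Impact a b →
      Reach ε Sec b w → Reach ε Sec z w

/-! ### The section and the first return -/

/-- The section `Σ_h`: `p₁ = 0`, `dp₁/dt < 0`, `H = h`. -/
def sect (h ε : ℝ) : Set Phase :=
  {z | z.1 ∈ M.config ∧ z.2.1 = 0 ∧ M.force₁ ε z.1 < 0 ∧ M.energy ε z = h}

/-- `z'` is the first return to `Σ_h` of the impact trajectory that starts at `z ∈ Σ_h`. -/
def FirstReturn (h ε : ℝ) (z z' : Phase) : Prop :=
  z ∈ M.sect h ε ∧ z' ∈ M.sect h ε ∧ M.Reach ε (M.sect h ε) z z'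

/-! ### Action-angle coordinates of the unperturbed vertical oscillator -/

/-- The energy of the unperturbed vertical oscillator. -/
def energy₂ (q p : ℝ) : ℝ := p ^ 2 / 2 + M.V₂ q

/-- The action of the vertical oscillator at energy `E`: the area enclosed by the level curve of
energy `E` in the `(q₂, p₂)`-plane, divided by `2π`. -/
def action (E : ℝ) : ℝ :=
  (MeasureTheory.volume {x : ℝ × ℝ | x.1 ∈ M.D₂ ∧ M.energy₂ x.1 x.2 ≤ E}).toReal /
    (2 * Real.pi)

/-- The largest value of `q₂` at energy `E`. -/
def q₂max (E : ℝ) : ℝ := sSup {q | q ∈ M.D₂ ∧ M.V₂ q ≤ E}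

/-- The smallest value of `q₂` at energy `E`. -/
def q₂min (E : ℝ) : ℝ := sInf {q | q ∈ M.D₂ ∧ M.V₂ q ≤ E}

/-- The period of the vertical oscillator at energy `E`. -/
def period₂ (E : ℝ) : ℝ :=
  2 * ∫ s in (M.q₂min E)..(M.q₂max E), 1 / Real.sqrt (2 * (E - M.V₂ s))

/-- The travel time of the vertical oscillator, at energy `E`, between `q` and `q₂max E`. -/
def travelTime₂ (E q : ℝ) : ℝ :=
  ∫ s in q..(M.q₂max E), 1 / Real.sqrt (2 * (E - M.V₂ s))

/-- The angle of the vertical oscillator: frequency times the time elapsed since the maximum of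
`q₂`, so that `θ = 0` at `p₂ = 0`, `dp₂/dt < 0`. It is positive for `p₂ < 0`, negative
for `p₂ > 0`. -/
def angle (q p : ℝ) : Real.Angle :=
  let E := M.energy₂ q p
  (((if p ≤ 0 then 1 else -1) * (2 * Real.pi / M.period₂ E * M.travelTime₂ E q) : ℝ) :
    Real.Angle)

/-- The coordinates `(θ, I) = S₂(q₂, p₂)` of a phase point. -/
def angleAction (z : Phase) : Cylinder :=
  (M.angle z.1.2 z.2.2, M.action (M.energy₂ z.1.2 z.2.2))

/-- The graph of the first return map to `Σ_h` in the coordinates `(θ, I)`. -/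
def ReturnAA (h ε : ℝ) (x y : Cylinder) : Prop :=
  ∃ z z' : Phase, M.FirstReturn h ε z z' ∧ M.angleAction z = x ∧ M.angleAction z' = y

/-! ### The tangential curve and the normal coordinates -/

/-- The tangential curve, in the coordinates `(θ, I)`: initial conditions on `Σ_h` whose impact
trajectory touches the line `q₁ = q₁w` tangentially (possibly at the corner) before its first
return to `Σ_h`. -/
def tangentialCurve (h ε : ℝ) : Set Cylinder :=
  {x | ∃ z ∈ M.sect h ε, M.angleAction z = x ∧
    ∃ w, M.Reach ε (M.sect h ε) z w ∧ w.1.1 = M.q₁w ∧ w.2.1 = 0}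

/-- `I_tan^ε`, the function of which the tangential curve is the graph over `θ`. -/
def Itan (h ε : ℝ) (θ : Real.Angle) : ℝ :=
  Classical.epsilon fun I : ℝ => (θ, I) ∈ M.tangentialCurve h ε

theorem Itan_eq_iff {h ε : ℝ} {θ : Real.Angle}
    (hg : ∃! I : ℝ, (θ, I) ∈ M.tangentialCurve h ε) (I : ℝ) :
    (θ, I) ∈ M.tangentialCurve h ε ↔ I = M.Itan h ε θ := by
  have hs : (θ, M.Itan h ε θ) ∈ M.tangentialCurve h ε :=
    Classical.epsilon_spec (p := fun I : ℝ => (θ, I) ∈ M.tangentialCurve h ε) hg.exists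
  exact ⟨fun hI => hg.unique hI hs, fun hI => hI ▸ hs⟩

/-- The normal coordinates `(φ, K) = S(θ, I) = (θ, I - I_tan^ε(θ))`. -/
def normal (h ε : ℝ) : Cylinder ≃ Cylinder where
  toFun x := (x.1, x.2 - M.Itan h ε x.1)
  invFun u := (u.1, u.2 + M.Itan h ε u.1)
  left_inv x := by simp
  right_inv u := by simp

/-- A partial map `F` of the cylinder, given in the coordinates `(θ, I)`, expressed in the normal
coordinates: `S F S⁻¹`. -/
def inNormal (h ε : ℝ) (F : Cylinder ≃. Cylinder) : Cylinder ≃. Cylinder :=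
  ((M.normal h ε).symm.toPEquiv.trans F).trans (M.normal h ε).toPEquiv

/-- The function `φ ↦ ε f(φ; ε) = I_tan^ε(-φ) - I_tan^ε(φ)`. -/
def epsF (h ε : ℝ) (φ : Real.Angle) : ℝ := M.Itan h ε (-φ) - M.Itan h ε φ

/-- `R_ε(φ, K) = (-φ, K - ε f(φ))`. -/
def reversor (h ε : ℝ) (u : Cylinder) : Cylinder := (-u.1, u.2 - M.epsF h ε u.1)

end StepSystem

end

open Filter Topology MeasureTheory

noncomputable section

namespace StepSystem

variable {r : ℕ} (M : StepSystem r)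

/-! ### Time reversal -/

/-- The time reversal `(q, p) ↦ (q, -p)` of the phase space. -/
def timeReversal (z : Phase) : Phase := (z.1, -z.2)

@[simp] theorem timeReversal_fst (z : Phase) : (timeReversal z).1 = z.1 := rfl

@[simp] theorem timeReversal_snd (z : Phase) : (timeReversal z).2 = -z.2 := rfl

theorem energy_timeReversal (ε : ℝ) (z : Phase) :
    M.energy ε (timeReversal z) = M.energy ε z := by
  simp [energy, timeReversal]

theorem vectorField_timeReversal (ε : ℝ) (z : Phase) :
    M.vectorField ε (timeReversal z) = -timeReversal (M.vectorField ε z) := by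
  ext <;> simp [vectorField, timeReversal]

theorem timeReversal_mem_sect {h ε : ℝ} {z : Phase} :
    timeReversal z ∈ M.sect h ε ↔ z ∈ M.sect h ε := by
  simp [sect, energy_timeReversal]

theorem Impact.timeReversal {M : StepSystem r} {z z' : Phase} (hz : M.Impact z z') :
    M.Impact (timeReversal z') (timeReversal z) := by
  obtain ⟨h1, h2, h3, rfl⟩ | ⟨h1, h2, h3, rfl⟩ := hz
  · left
    refine ⟨h1, h2, by simpa using h3, ?_⟩
    ext <;> simp
  · right
    refine ⟨h1, h2, by simpa using h3, ?_⟩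
    ext <;> simp

theorem Impact.mem_sect {M : StepSystem r} {h ε : ℝ} {z z' : Phase} (hz : M.Impact z z')
    (hz' : z' ∈ M.sect h ε) : z ∈ M.sect h ε := by
  obtain ⟨h1, h2, h3, rfl⟩ | ⟨h1, h2, h3, rfl⟩ := hz
  · have := hz'.2.1
    simp at this
    linarith
  · simpa [sect, energy] using hz'

theorem FreeArc.timeReversal {M : StepSystem r} {h ε : ℝ} {z w : Phase}
    (ha : M.FreeArc ε (M.sect h ε) z w) :
    M.FreeArc ε (M.sect h ε) (timeReversal w) (timeReversal z) := by
  obtain ⟨τ, γ, hτ, h0, h1, hγ, hI⟩ := ha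
  refine ⟨τ, fun t => StepSystem.timeReversal (γ (τ - t)), hτ, by simp [h1], by simp [h0],
    fun t ht => ?_, fun t ht => ?_⟩
  · have ht' : τ - t ∈ Icc 0 τ := ⟨by linarith [ht.2], by linarith [ht.1]⟩
    refine ⟨(hγ _ ht').1, ?_⟩
    have hd : HasDerivWithinAt (fun t => γ (τ - t)) (-M.vectorField ε (γ (τ - t))) (Icc 0 τ) t := by
      have := (hγ _ ht').2.scomp t (((hasDerivAt_id t).const_sub τ).hasDerivWithinAt (s := Icc 0 τ))
        (fun s hs => ⟨by simpa using hs.2, by simpa using hs.1⟩)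
      simpa [Function.comp_def] using this
    have hfst := (hasFDerivAt_fst (𝕜 := ℝ) (p := γ (τ - t))).comp_hasDerivWithinAt t hd
    have hsnd := (hasFDerivAt_snd (𝕜 := ℝ) (p := γ (τ - t))).comp_hasDerivWithinAt t hd
    have := hfst.prodMk hsnd.neg
    rw [vectorField_timeReversal]
    exact this.congr_deriv (by ext <;> simp)
  · have ht' : τ - t ∈ Ioo 0 τ := ⟨by linarith [ht.2], by linarith [ht.1]⟩
    refine ⟨(hI _ ht').1, ?_⟩
    rw [timeReversal_mem_sect]
    exact (hI _ ht').2

theorem Reach.append_impact_arc {M : StepSystem r} {ε : ℝ} {Sec : Set Phase} {z a b w : Phase}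
    (hz : M.Reach ε Sec z a) (ha : a ∉ Sec) (hab : M.Impact a b) (hb : M.FreeArc ε Sec b w) :
    M.Reach ε Sec z w := by
  induction hz with
  | arc h => exact .impact h ha hab (.arc hb)
  | impact h1 h2 h3 _ ih => exact .impact h1 h2 h3 (ih ha hab)

theorem Reach.timeReversal {M : StepSystem r} {h ε : ℝ} {z w : Phase}
    (hz : M.Reach ε (M.sect h ε) z w) :
    M.Reach ε (M.sect h ε) (timeReversal w) (timeReversal z) := by
  induction hz with
  | arc h => exact .arc h.timeReversal
  | impact h1 h2 h3 _ ih =>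
    refine ih.append_impact_arc (fun hb => h2 ?_) h3.timeReversal h1.timeReversal
    exact h3.mem_sect (M.timeReversal_mem_sect.1 hb)

theorem FirstReturn.timeReversal {M : StepSystem r} {h ε : ℝ} {z w : Phase}
    (hz : M.FirstReturn h ε z w) : M.FirstReturn h ε (timeReversal w) (timeReversal z) :=
  ⟨M.timeReversal_mem_sect.2 hz.2.1, M.timeReversal_mem_sect.2 hz.1, hz.2.2.timeReversal⟩

/-! ### Determinism of the impact flow -/

theorem contDiffOn_vectorField (hr : 2 ≤ r) (ε : ℝ) :
    ContDiffOn ℝ 1 (M.vectorField ε) {z | z.1 ∈ M.D₁ ×ˢ M.D₂} := by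
  have hr' : (1 : WithTop ℕ∞) + 1 ≤ (r : WithTop ℕ∞) := by
    norm_num
    exact_mod_cast hr
  have h1 : ContDiffOn ℝ 1 (deriv M.V₁) M.D₁ :=
    M.contDiffOn_V₁.deriv_of_isOpen M.isOpen_D₁ hr'
  have h2 : ContDiffOn ℝ 1 (deriv M.V₂) M.D₂ :=
    M.contDiffOn_V₂.deriv_of_isOpen M.isOpen_D₂ hr'
  have h3 : ContDiffOn ℝ 1 (fderiv ℝ M.Vc) (M.D₁ ×ˢ M.D₂) :=
    M.contDiffOn_Vc.fderiv_of_isOpen (M.isOpen_D₁.prod M.isOpen_D₂) hr'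
  have k1 : ContDiffOn ℝ 1 (fun z : Phase => deriv M.V₁ z.1.1) {z | z.1 ∈ M.D₁ ×ˢ M.D₂} :=
    h1.comp (g := deriv M.V₁) (f := fun z : Phase => z.1.1) (by fun_prop) fun z hz => hz.1
  have k2 : ContDiffOn ℝ 1 (fun z : Phase => deriv M.V₂ z.1.2) {z | z.1 ∈ M.D₁ ×ˢ M.D₂} :=
    h2.comp (g := deriv M.V₂) (f := fun z : Phase => z.1.2) (by fun_prop) fun z hz => hz.2
  have k3 : ContDiffOn ℝ 1 (fun z : Phase => fderiv ℝ M.Vc z.1) {z | z.1 ∈ M.D₁ ×ˢ M.D₂} :=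
    h3.comp (g := fderiv ℝ M.Vc) (f := fun z : Phase => z.1) (by fun_prop) fun z hz => hz
  unfold vectorField force₁ force₂
  refine ContDiffOn.prodMk (by fun_prop) (ContDiffOn.prodMk ?_ ?_)
  · exact k1.neg.sub (contDiffOn_const.mul (k3.clm_apply contDiffOn_const))
  · exact k2.neg.sub (contDiffOn_const.mul (k3.clm_apply contDiffOn_const))

theorem locallyLipschitzOn_vectorField (hr : 2 ≤ r) (ε : ℝ) {s : Set Phase}
    (hs : s ⊆ {z | z.1 ∈ M.D₁ ×ˢ M.D₂}) : LocallyLipschitzOn s (M.vectorField ε) := by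
  intro z hz
  have ho : IsOpen {z : Phase | z.1 ∈ M.D₁ ×ˢ M.D₂} :=
    (M.isOpen_D₁.prod M.isOpen_D₂).preimage continuous_fst
  obtain ⟨K, t, ht, hK⟩ :=
    ((M.contDiffOn_vectorField hr ε).contDiffAt (ho.mem_nhds (hs hz))).exists_lipschitzOnWith
  exact ⟨K, t, mem_nhdsWithin_of_mem_nhds ht, hK⟩

theorem eqOn_of_hasDerivWithinAt (hr : 2 ≤ r) {ε τ : ℝ} {γ γ' : ℝ → Phase}
    (hγ : ∀ t ∈ Icc 0 τ, (γ t).1 ∈ M.config ∧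
      HasDerivWithinAt γ (M.vectorField ε (γ t)) (Icc 0 τ) t)
    (hγ' : ∀ t ∈ Icc 0 τ, (γ' t).1 ∈ M.config ∧
      HasDerivWithinAt γ' (M.vectorField ε (γ' t)) (Icc 0 τ) t)
    (h0 : γ 0 = γ' 0) : EqOn γ γ' (Icc 0 τ) := by
  have hc : ContinuousOn γ (Icc 0 τ) := fun t ht => (hγ t ht).2.continuousWithinAt
  have hc' : ContinuousOn γ' (Icc 0 τ) := fun t ht => (hγ' t ht).2.continuousWithinAt
  have hsub : γ '' Icc 0 τ ∪ γ' '' Icc 0 τ ⊆ {z | z.1 ∈ M.D₁ ×ˢ M.D₂} := by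
    rintro _ (⟨t, ht, rfl⟩ | ⟨t, ht, rfl⟩)
    exacts [(hγ t ht).1.1, (hγ' t ht).1.1]
  obtain ⟨K, hK⟩ := (M.locallyLipschitzOn_vectorField hr ε hsub).exists_lipschitzOnWith_of_compact
    ((isCompact_Icc.image_of_continuousOn hc).union (isCompact_Icc.image_of_continuousOn hc'))
  have hright {δ : ℝ → Phase} (hδ : ∀ t ∈ Icc 0 τ, (δ t).1 ∈ M.config ∧
      HasDerivWithinAt δ (M.vectorField ε (δ t)) (Icc 0 τ) t) (t : ℝ) (ht : t ∈ Ico 0 τ) :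
      HasDerivWithinAt δ (M.vectorField ε (δ t)) (Ici t) t :=
    (hδ t (Ico_subset_Icc_self ht)).2.mono_of_mem_nhdsWithin
      (mem_of_superset (Icc_mem_nhdsGE ht.2) (Icc_subset_Icc_left ht.1))
  exact ODE_solution_unique_of_mem_Icc_right (v := fun _ => M.vectorField ε)
    (fun t _ => hK) hc (hright hγ) (fun t ht => .inl ⟨t, Ico_subset_Icc_self ht, rfl⟩)
    hc' (hright hγ') (fun t ht => .inr ⟨t, Ico_subset_Icc_self ht, rfl⟩) h0

theorem eventually_lt_of_hasDerivWithinAt_neg {f : ℝ → ℝ} {f' x y : ℝ} (hxy : x < y)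
    (hf : HasDerivWithinAt f f' (Icc x y) x) (hf' : f' < 0) : ∀ᶠ t in 𝓝[>] x, f t < f x := by
  have hs := hf.limsup_slope_le hf'
  have hle : 𝓝[>] x ≤ 𝓝[Icc x y \ {x}] x := by
    rw [Icc_sdiff_left, nhdsWithin_Ioc_eq_nhdsGT hxy]
  filter_upwards [hle hs, self_mem_nhdsWithin] with t ht hxt
  rw [slope_def_field, div_neg_iff] at ht
  rcases ht with ht | ht
  · linarith [ht.2, mem_Ioi.1 hxt]
  · linarith

/-- A state at which an impact happens cannot be an interior point of a free arc. -/
theorem Impact.not_lt_time {M : StepSystem r} {ε σ τ : ℝ} {γ : ℝ → Phase} {b : Phase}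
    (hγ : ∀ t ∈ Icc 0 τ, (γ t).1 ∈ M.config ∧
      HasDerivWithinAt γ (M.vectorField ε (γ t)) (Icc 0 τ) t)
    (hσ : 0 ≤ σ) (hb : M.Impact (γ σ) b) : ¬ σ < τ := by
  intro hστ
  have hd : HasDerivWithinAt γ (M.vectorField ε (γ σ)) (Icc σ τ) σ :=
    (hγ σ ⟨hσ, hστ.le⟩).2.mono (Icc_subset_Icc_left hσ)
  have hq := (hasFDerivAt_fst (𝕜 := ℝ) (p := γ σ)).comp_hasDerivWithinAt σ hd
  have hq1 := (hasFDerivAt_fst (𝕜 := ℝ) (p := (γ σ).1)).comp_hasDerivWithinAt σ hq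
  have hq2 := (hasFDerivAt_snd (𝕜 := ℝ) (p := (γ σ).1)).comp_hasDerivWithinAt σ hq
  have hlt : ∀ᶠ t in 𝓝[>] σ, t ∈ Icc 0 τ := by
    filter_upwards [Ioo_mem_nhdsGT hστ] with t ht
    exact ⟨hσ.trans ht.1.le, ht.2.le⟩
  have hle : 𝓝[>] σ ≤ 𝓝[Icc σ τ] σ := by
    rw [← nhdsWithin_Ioc_eq_nhdsGT hστ]
    exact nhdsWithin_mono _ Ioc_subset_Icc_self
  obtain ⟨h1, h2, h3, -⟩ | ⟨h1, h2, h3, -⟩ := hb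
  · have e1 := eventually_lt_of_hasDerivWithinAt_neg hστ hq1 h3
    have e2 := hle (hq2.continuousWithinAt.eventually_lt continuousWithinAt_const h2)
    obtain ⟨t, ht, ht1, ht2⟩ := (hlt.and (e1.and e2)).exists
    exact (hγ t ht).1.2 ⟨by simpa [h1] using ht1, ht2⟩
  · have e1 := eventually_lt_of_hasDerivWithinAt_neg hστ hq2 h3
    have e2 := hle (hq1.continuousWithinAt.eventually_lt continuousWithinAt_const h2)
    obtain ⟨t, ht, ht1, ht2⟩ := (hlt.and (e1.and e2)).exists
    exact (hγ t ht).1.2 ⟨ht2, by simpa [h1] using ht1⟩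

theorem Impact.unique {M : StepSystem r} {z b b' : Phase} (hb : M.Impact z b)
    (hb' : M.Impact z b') : b = b' := by
  obtain ⟨h1, h2, h3, rfl⟩ | ⟨h1, h2, h3, rfl⟩ := hb <;>
  obtain ⟨h1', h2', h3', rfl⟩ | ⟨h1', h2', h3', rfl⟩ := hb'
  · rfl
  · linarith
  · linarith
  · rfl

/-- The first event (an impact or an arrival at the section) along the free flow is unique. -/
theorem FreeArc.unique {M : StepSystem r} (hr : 2 ≤ r) {ε : ℝ} {Sec : Set Phase} {z w w' : Phase}
    (h : M.FreeArc ε Sec z w) (h' : M.FreeArc ε Sec z w')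
    (hw : w ∈ Sec ∨ ∃ b, M.Impact w b) (hw' : w' ∈ Sec ∨ ∃ b, M.Impact w' b) : w = w' := by
  have key : ∀ {τ τ' : ℝ} {γ γ' : ℝ → Phase}, 0 < τ → γ 0 = γ' 0 →
      (∀ t ∈ Icc 0 τ, (γ t).1 ∈ M.config ∧
        HasDerivWithinAt γ (M.vectorField ε (γ t)) (Icc 0 τ) t) →
      (∀ t ∈ Icc 0 τ', (γ' t).1 ∈ M.config ∧
        HasDerivWithinAt γ' (M.vectorField ε (γ' t)) (Icc 0 τ') t) →
      (∀ t ∈ Ioo 0 τ', (γ' t).1 ≠ M.corner ∧ γ' t ∉ Sec) →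
      (γ τ ∈ Sec ∨ ∃ b, M.Impact (γ τ) b) → τ ≤ τ' → τ = τ' ∧ γ τ = γ' τ' := by
    intro τ τ' γ γ' hτ h0 hγ hγ' hI hE hle
    have heq := M.eqOn_of_hasDerivWithinAt hr hγ
      (fun t ht => ⟨(hγ' t ⟨ht.1, ht.2.trans hle⟩).1,
        (hγ' t ⟨ht.1, ht.2.trans hle⟩).2.mono (Icc_subset_Icc_right hle)⟩) h0
      (right_mem_Icc.2 hτ.le)
    have hτ' : τ = τ' := by
      refine hle.eq_of_not_lt fun hlt => ?_
      rw [heq] at hE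
      rcases hE with hE | ⟨b, hb⟩
      · exact (hI τ ⟨hτ, hlt⟩).2 hE
      · exact hb.not_lt_time hγ' hτ.le hlt
    subst hτ'
    exact ⟨rfl, heq⟩
  obtain ⟨τ, γ, hτ, h0, rfl, hγ, hI⟩ := h
  obtain ⟨τ', γ', hτ', h0', rfl, hγ', hI'⟩ := h'
  rcases le_total τ τ' with hle | hle
  · exact (key hτ (h0.trans h0'.symm) hγ hγ' hI' hw hle).2
  · exact (key hτ' (h0'.trans h0.symm) hγ' hγ hI hw' hle).2.symm

theorem Reach.unique {M : StepSystem r} (hr : 2 ≤ r) {ε : ℝ} {Sec : Set Phase} {z w w' : Phase}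
    (h : M.Reach ε Sec z w) (h' : M.Reach ε Sec z w') (hw : w ∈ Sec) (hw' : w' ∈ Sec) :
    w = w' := by
  induction h with
  | arc h =>
    cases h' with
    | arc h' => exact h.unique hr h' (.inl hw) (.inl hw')
    | impact h' ha hi _ =>
      exact absurd (h.unique hr h' (.inl hw) (.inr ⟨_, hi⟩) ▸ hw) ha
  | impact h ha hi _ ih =>
    cases h' with
    | arc h' => exact absurd (h.unique hr h' (.inr ⟨_, hi⟩) (.inl hw') ▸ hw') ha
    | impact h' ha' hi' hr' =>
      obtain rfl := h.unique hr h' (.inr ⟨_, hi⟩) (.inr ⟨_, hi'⟩)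
      obtain rfl := hi.unique hi'
      exact ih hr' hw

end StepSystem

/-- A potential `V` of class `C¹` on the open interval `D` with its only critical point, a strict
global minimum of height `0`, at the origin. -/
structure IsPotentialWell (D : Set ℝ) (V : ℝ → ℝ) : Prop where
  isOpen : IsOpen D
  ordConnected : D.OrdConnected
  zero_mem : (0 : ℝ) ∈ D
  contDiffOn : ContDiffOn ℝ 1 V D
  map_zero : V 0 = 0
  mul_deriv_pos : ∀ q ∈ D, q ≠ 0 → 0 < q * deriv V q

namespace IsPotentialWell

variable {D : Set ℝ} {V : ℝ → ℝ}

theorem comp_neg (W : IsPotentialWell D V) :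
    IsPotentialWell (Neg.neg ⁻¹' D) (fun q => V (-q)) where
  isOpen := W.isOpen.preimage continuous_neg
  ordConnected := W.ordConnected.preimage_anti fun _ _ h => neg_le_neg h
  zero_mem := by simpa using W.zero_mem
  contDiffOn := W.contDiffOn.comp contDiff_neg.contDiffOn fun _ h => h
  map_zero := by simpa using W.map_zero
  mul_deriv_pos q hq h0 := by
    have := W.mul_deriv_pos (-q) hq (neg_ne_zero.2 h0)
    rw [deriv_comp_neg]
    linarith

theorem differentiableAt (W : IsPotentialWell D V) {q : ℝ} (hq : q ∈ D) :
    DifferentiableAt ℝ V q :=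
  (W.contDiffOn.contDiffAt (W.isOpen.mem_nhds hq)).differentiableAt one_ne_zero

theorem continuousOn (W : IsPotentialWell D V) : ContinuousOn V D := W.contDiffOn.continuousOn

theorem continuousOn_deriv (W : IsPotentialWell D V) : ContinuousOn (deriv V) D :=
  (W.contDiffOn.deriv_of_isOpen (m := 0) W.isOpen (by norm_num)).continuousOn

theorem strictMonoOn (W : IsPotentialWell D V) : StrictMonoOn V (D ∩ Ici 0) := by
  refine strictMonoOn_of_deriv_pos (W.ordConnected.inter ordConnected_Ici).convex
    (W.continuousOn.mono inter_subset_left) fun q hq => ?_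
  rw [interior_inter, W.isOpen.interior_eq, interior_Ici] at hq
  exact pos_of_mul_pos_right (W.mul_deriv_pos q hq.1 (ne_of_gt hq.2)) (le_of_lt hq.2)

theorem strictAntiOn (W : IsPotentialWell D V) : StrictAntiOn V (D ∩ Iic 0) := by
  intro x hx y hy hxy
  have := W.comp_neg.strictMonoOn (a := -y) (b := -x) ⟨by simpa using hy.1, by simpa using hy.2⟩
    ⟨by simpa using hx.1, by simpa using hx.2⟩ (neg_lt_neg hxy)
  simpa using this

theorem pos (W : IsPotentialWell D V) {q : ℝ} (hq : q ∈ D) (h0 : q ≠ 0) : 0 < V q := by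
  rw [← W.map_zero]
  rcases lt_or_gt_of_ne h0 with h | h
  · exact W.strictAntiOn ⟨hq, h.le⟩ ⟨W.zero_mem, mem_Iic.2 le_rfl⟩ h
  · exact W.strictMonoOn ⟨W.zero_mem, mem_Ici.2 le_rfl⟩ ⟨hq, h.le⟩ h

theorem nonneg (W : IsPotentialWell D V) {q : ℝ} (hq : q ∈ D) : 0 ≤ V q := by
  rcases eq_or_ne q 0 with rfl | h
  · exact W.map_zero.ge
  · exact (W.pos hq h).le

theorem exists_pos_eq (W : IsPotentialWell D V) {E q : ℝ} (hE : 0 < E) (hq : q ∈ D) (h0 : 0 < q)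
    (hEq : E ≤ V q) : ∃ v ∈ D, 0 < v ∧ V v = E := by
  have hsub : Icc 0 q ⊆ D := W.ordConnected.out W.zero_mem hq
  obtain ⟨v, hv, rfl⟩ := intermediate_value_Icc h0.le (W.continuousOn.mono hsub)
    ⟨W.map_zero.trans_le hE.le, hEq⟩
  refine ⟨v, hsub hv, hv.1.lt_of_ne ?_, rfl⟩
  rintro rfl
  exact hE.ne' W.map_zero

theorem le_iff_of_nonneg (W : IsPotentialWell D V) {q v : ℝ} (hv : v ∈ D) (hv0 : 0 ≤ v)
    (hq : q ∈ D) (hq0 : 0 ≤ q) : V q ≤ V v ↔ q ≤ v :=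
  W.strictMonoOn.le_iff_le ⟨hq, hq0⟩ ⟨hv, hv0⟩

theorem le_iff_of_nonpos (W : IsPotentialWell D V) {q v : ℝ} (hv : v ∈ D) (hv0 : v ≤ 0)
    (hq : q ∈ D) (hq0 : q ≤ 0) : V q ≤ V v ↔ v ≤ q :=
  W.strictAntiOn.le_iff_ge ⟨hq, hq0⟩ ⟨hv, hv0⟩

/-- The turning points of the motion of energy `E`. -/
theorem exists_turning_points (W : IsPotentialWell D V) {E h : ℝ} (hc : Confines D V h)
    (hE : 0 < E) (hEh : E ≤ h) : ∃ u v : ℝ, u ∈ D ∧ v ∈ D ∧ u < 0 ∧ 0 < v ∧ V u = E ∧ V v = E ∧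
      {q | q ∈ D ∧ V q ≤ E} = Icc u v := by
  obtain ⟨⟨q, hq, hq0, hqh⟩, q', hq', hq0', hqh'⟩ := hc
  obtain ⟨v, hv, hv0, hvE⟩ := W.exists_pos_eq hE hq' hq0' (hEh.trans hqh'.le)
  obtain ⟨u, hu, hu0, huE⟩ := W.comp_neg.exists_pos_eq (q := -q) hE (by simpa using hq)
    (by linarith) (by simpa using hEh.trans hqh.le)
  refine ⟨-u, v, hu, hv, by linarith, hv0, huE, hvE, ?_⟩
  ext x
  have hout : x ∈ Icc (-u) v → x ∈ D := fun hx => W.ordConnected.out hu hv hx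
  rcases le_total 0 x with hx | hx
  · constructor
    · rintro ⟨h1, h2⟩
      exact ⟨by linarith, (W.le_iff_of_nonneg hv hv0.le h1 hx).1 (h2.trans hvE.ge)⟩
    · intro h1
      exact ⟨hout h1, ((W.le_iff_of_nonneg hv hv0.le (hout h1) hx).2 h1.2).trans hvE.le⟩
  · constructor
    · rintro ⟨h1, h2⟩
      exact ⟨(W.le_iff_of_nonpos hu (by linarith) h1 hx).1 (h2.trans huE.ge), by linarith⟩
    · intro h1
      exact ⟨hout h1, ((W.le_iff_of_nonpos hu (by linarith) (hout h1) hx).2 h1.1).trans huE.le⟩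

theorem eq_turning_point (W : IsPotentialWell D V) {u v q : ℝ} (hu : u ∈ D) (hv : v ∈ D)
    (hu0 : u < 0) (hv0 : 0 < v) (huv : V u = V v) (hq : q ∈ D) (hqv : V q = V v) :
    q = u ∨ q = v := by
  rcases le_total 0 q with h | h
  · exact .inr (W.strictMonoOn.injOn ⟨hq, h⟩ ⟨hv, hv0.le⟩ hqv)
  · exact .inl (W.strictAntiOn.injOn ⟨hq, h⟩ ⟨hu, hu0.le⟩ (hqv.trans huv.symm))

/-- The potential decreases at least linearly away from a turning point. -/
theorem exists_le_sub (W : IsPotentialWell D V) {v : ℝ} (hv : v ∈ D) (hv0 : 0 < v) :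
    ∃ c > 0, ∀ s ∈ Icc 0 v, c * (v - s) ≤ V v - V s := by
  have hsub : Icc 0 v ⊆ D := W.ordConnected.out W.zero_mem hv
  have hcont : ContinuousOn (dslope V v) (Icc 0 v) :=
    ((continuousOn_dslope (W.isOpen.mem_nhds hv)).2
      ⟨W.continuousOn, W.differentiableAt hv⟩).mono hsub
  obtain ⟨m, hm, hmin⟩ := isCompact_Icc.exists_isMinOn ⟨0, left_mem_Icc.2 hv0.le⟩ hcont
  refine ⟨dslope V v m, ?_, fun s hs => ?_⟩
  · rcases hm.2.eq_or_lt with rfl | hlt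
    · rw [dslope_same]
      exact pos_of_mul_pos_right (W.mul_deriv_pos _ hv hv0.ne') hv0.le
    · rw [dslope_of_ne _ hlt.ne, slope_def_field]
      have := W.strictMonoOn ⟨hsub hm, hm.1⟩ ⟨hv, hv0.le⟩ hlt
      exact div_pos_of_neg_of_neg (by linarith) (by linarith)
  · have h1 : dslope V v m ≤ dslope V v s := hmin hs
    have h2 := sub_smul_dslope V v s
    rw [smul_eq_mul] at h2
    nlinarith [mul_le_mul_of_nonneg_right h1 (sub_nonneg.2 hs.2)]

theorem intervalIntegrable_right (W : IsPotentialWell D V) {v : ℝ} (hv : v ∈ D) (hv0 : 0 < v) :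
    IntervalIntegrable (fun s => 1 / √(2 * (V v - V s))) volume 0 v := by
  obtain ⟨c, hc, hcV⟩ := W.exists_le_sub hv hv0
  have hsub : Icc 0 v ⊆ D := W.ordConnected.out W.zero_mem hv
  have hpos : ∀ s ∈ Ioo 0 v, 0 < V v - V s := fun s hs =>
    (mul_pos hc (sub_pos.2 hs.2)).trans_le (hcV s (Ioo_subset_Icc_self hs))
  have hint : IntervalIntegrable (fun s => 1 / √(2 * c) * (v - s) ^ (-(1 / 2) : ℝ))
      volume 0 v := by
    have := ((intervalIntegral.intervalIntegrable_rpow' (a := 0) (b := v)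
      (show (-1 : ℝ) < -(1 / 2) by norm_num)).comp_sub_left v).symm
    rw [sub_zero, sub_self] at this
    exact this.const_mul _
  rw [intervalIntegrable_iff_integrableOn_Ioo_of_le hv0.le] at hint ⊢
  refine hint.mono' (ContinuousOn.aestronglyMeasurable ?_ measurableSet_Ioo)
    (ae_restrict_of_forall_mem measurableSet_Ioo fun s hs => ?_)
  · refine continuousOn_const.div
      ((continuousOn_const.mul (continuousOn_const.sub
        (W.continuousOn.mono (Ioo_subset_Icc_self.trans hsub)))).sqrt) fun s hs => ?_
    exact (Real.sqrt_pos.2 (mul_pos two_pos (hpos s hs))).ne'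
  · have hvs : 0 < v - s := sub_pos.2 hs.2
    rw [Real.norm_of_nonneg (by positivity), Real.rpow_neg hvs.le, ← Real.sqrt_eq_rpow,
      ← one_div, one_div_mul_one_div, ← Real.sqrt_mul (by positivity)]
    refine one_div_le_one_div_of_le (Real.sqrt_pos.2 (by positivity)) (Real.sqrt_le_sqrt ?_)
    have := hcV s (Ioo_subset_Icc_self hs)
    linarith

theorem intervalIntegrable_inv_speed (W : IsPotentialWell D V) {E u v : ℝ} (hu : u ∈ D)
    (hv : v ∈ D) (hu0 : u < 0) (hv0 : 0 < v) (huE : V u = E) (hvE : V v = E) :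
    IntervalIntegrable (fun s => 1 / √(2 * (E - V s))) volume u v := by
  have h1 := W.intervalIntegrable_right hv hv0
  have h2 := (W.comp_neg.intervalIntegrable_right (v := -u) (by simpa using hu)
    (by linarith)).comp_sub_left 0
  simp only [zero_sub, neg_neg, sub_zero] at h2
  rw [hvE] at h1
  rw [huE] at h2
  exact h2.symm.trans h1

end IsPotentialWell

namespace StepSystem

variable {r : ℕ} (M : StepSystem r)

theorem isPotentialWell₁ (hr : 1 ≤ r) : IsPotentialWell M.D₁ M.V₁ where
  isOpen := M.isOpen_D₁
  ordConnected := M.ordConnected_D₁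
  zero_mem := M.zero_mem_D₁
  contDiffOn := M.contDiffOn_V₁.of_le (by exact_mod_cast hr)
  map_zero := M.V₁_zero
  mul_deriv_pos := M.V₁_convex

theorem isPotentialWell₂ (hr : 1 ≤ r) : IsPotentialWell M.D₂ M.V₂ where
  isOpen := M.isOpen_D₂
  ordConnected := M.ordConnected_D₂
  zero_mem := M.zero_mem_D₂
  contDiffOn := M.contDiffOn_V₂.of_le (by exact_mod_cast hr)
  map_zero := M.V₂_zero
  mul_deriv_pos := M.V₂_convex

/-! ### The action of the vertical oscillator -/

/-- The region of the `(q₂, p₂)`-plane enclosed by the level curve of energy `E`. -/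
def sublevel (E : ℝ) : Set (ℝ × ℝ) := {x | x.1 ∈ M.D₂ ∧ M.energy₂ x.1 x.2 ≤ E}

theorem action_eq (E : ℝ) : M.action E = (volume (M.sublevel E)).toReal / (2 * Real.pi) := rfl

theorem sublevel_mono : Monotone M.sublevel := fun _ _ hE _ hx => ⟨hx.1, hx.2.trans hE⟩

theorem continuousOn_energy₂ :
    ContinuousOn (fun x : ℝ × ℝ => M.energy₂ x.1 x.2) (M.D₂ ×ˢ univ) := by
  have : ContinuousOn (fun x : ℝ × ℝ => M.V₂ x.1) (M.D₂ ×ˢ univ) :=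
    M.contDiffOn_V₂.continuousOn.comp continuousOn_fst fun x hx => hx.1
  unfold energy₂
  fun_prop

theorem isOpen_energy₂_preimage {s : Set ℝ} (hs : IsOpen s) :
    IsOpen {x : ℝ × ℝ | x.1 ∈ M.D₂ ∧ M.energy₂ x.1 x.2 ∈ s} := by
  have := M.continuousOn_energy₂.isOpen_inter_preimage (M.isOpen_D₂.prod isOpen_univ) hs
  convert this using 1
  ext x
  simp

theorem measurableSet_sublevel (E : ℝ) : MeasurableSet (M.sublevel E) := by
  have h1 := (M.isOpen_energy₂_preimage isOpen_univ).measurableSet.diff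
    (M.isOpen_energy₂_preimage (isOpen_Ioi (a := E))).measurableSet
  convert h1 using 1
  ext x
  simp only [sublevel, mem_ofPred_eq, Set.mem_sdiff, mem_Ioi, mem_univ, and_true, not_and, not_lt]
  tauto

theorem volume_sublevel_lt_top (hr : 1 ≤ r) {E h : ℝ} (hc : Confines M.D₂ M.V₂ h) (hh : 0 < h)
    (hE : E ≤ h) : volume (M.sublevel E) < ⊤ := by
  obtain ⟨u, v, hu, hv, hu0, hv0, huE, hvE, hset⟩ :=
    (M.isPotentialWell₂ hr).exists_turning_points hc hh le_rfl
  refine lt_of_le_of_lt (measure_mono (t := Icc u v ×ˢ Icc (-√(2 * h)) √(2 * h)) ?_)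
    (isCompact_Icc.prod isCompact_Icc).measure_lt_top
  rintro ⟨q, p⟩ ⟨hq, hqp⟩
  have hV := (M.isPotentialWell₂ hr).nonneg hq
  simp only [energy₂] at hqp hq hV
  refine ⟨hset ▸ ⟨hq, ?_⟩, abs_le.1 (Real.abs_le_sqrt ?_)⟩
  · nlinarith [sq_nonneg p]
  · dsimp only
    linarith

theorem action_mono (hr : 1 ≤ r) {E E' h : ℝ} (hc : Confines M.D₂ M.V₂ h) (hh : 0 < h)
    (hE : E ≤ E') (hE' : E' ≤ h) : M.action E ≤ M.action E' := by
  rw [action_eq, action_eq]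
  exact div_le_div_of_nonneg_right (ENNReal.toReal_mono
    (M.volume_sublevel_lt_top hr hc hh hE').ne (measure_mono (M.sublevel_mono hE))) (by positivity)

theorem action_strictMonoOn (hr : 1 ≤ r) {h : ℝ} (hc : Confines M.D₂ M.V₂ h) :
    StrictMonoOn M.action (Icc 0 h) := by
  intro E hE E' hE' hlt
  have hh : 0 < h := hE.1.trans_lt (hlt.trans_le hE'.2)
  set U := {x : ℝ × ℝ | x.1 ∈ M.D₂ ∧ M.energy₂ x.1 x.2 ∈ Ioo E E'} with hU
  have hUo : IsOpen U := M.isOpen_energy₂_preimage isOpen_Ioo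
  have hUne : U.Nonempty := by
    refine ⟨(0, √(E + E')), M.zero_mem_D₂, ?_⟩
    simp only [energy₂, M.V₂_zero, Real.sq_sqrt (add_nonneg hE.1 hE'.1)]
    constructor <;> linarith
  have hdisj : Disjoint (M.sublevel E) U :=
    disjoint_left.2 fun x hx hx' => hx.2.not_gt hx'.2.1
  have hsub : M.sublevel E ∪ U ⊆ M.sublevel E' :=
    union_subset (M.sublevel_mono hlt.le) fun x hx => ⟨hx.1, hx.2.2.le⟩
  have hfin := (M.volume_sublevel_lt_top hr hc hh hE.2).ne
  have hfin' := (M.volume_sublevel_lt_top hr hc hh hE'.2).ne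
  have hv : volume (M.sublevel E) < volume (M.sublevel E') := by
    refine lt_of_lt_of_le ?_ (measure_mono hsub)
    rw [measure_union hdisj hUo.measurableSet]
    exact ENNReal.lt_add_right hfin (hUo.measure_pos volume hUne).ne'
  rw [action_eq, action_eq]
  exact div_lt_div_of_pos_right ((ENNReal.toReal_lt_toReal hfin hfin').2 hv) (by positivity)

theorem pos_of_action_pos (hr : 1 ≤ r) {E : ℝ} (hE : 0 < M.action E) : 0 < E := by
  by_contra! hE0
  have hsub : M.sublevel E ⊆ {0} := by
    rintro ⟨q, p⟩ ⟨hq, hqp⟩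
    simp only [energy₂] at hqp hq
    have hV := (M.isPotentialWell₂ hr).nonneg hq
    have hp : p = 0 := by nlinarith [sq_nonneg p]
    have hq0 : q = 0 := by
      by_contra hne
      nlinarith [(M.isPotentialWell₂ hr).pos hq hne, sq_nonneg p]
    simp [hp, hq0]
  have h0 : volume (M.sublevel E) = 0 := measure_mono_null hsub (measure_singleton _)
  rw [action_eq, h0] at hE
  simp at hE

theorem lt_of_action_lt (hr : 1 ≤ r) {E E' h : ℝ} (hc : Confines M.D₂ M.V₂ h) (hh : 0 < h)
    (hpos : 0 < M.action E) (hlt : M.action E < M.action E') : E < E' := by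
  by_contra! hle
  rcases le_or_gt E h with hEh | hEh
  · exact (M.action_mono hr hc hh hle hEh).not_gt hlt
  · by_cases hfin : volume (M.sublevel E) = ⊤
    · rw [action_eq, hfin] at hpos
      simp at hpos
    · have h1 : M.action E' ≤ M.action E := by
        rw [action_eq, action_eq]
        exact div_le_div_of_nonneg_right (ENNReal.toReal_mono hfin
          (measure_mono (M.sublevel_mono hle))) (by positivity)
      exact h1.not_gt hlt

theorem volume_level_eq_zero (E : ℝ) :
    volume {x : ℝ × ℝ | x.1 ∈ M.D₂ ∧ M.energy₂ x.1 x.2 = E} = 0 := by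
  have hmeas : MeasurableSet {x : ℝ × ℝ | x.1 ∈ M.D₂ ∧ M.energy₂ x.1 x.2 = E} := by
    have := (M.measurableSet_sublevel E).diff
      (M.isOpen_energy₂_preimage (isOpen_Iio (a := E))).measurableSet
    convert this using 1
    ext x
    simp only [sublevel, mem_ofPred_eq, Set.mem_sdiff, mem_Iio, not_and, not_lt]
    exact ⟨fun hx => ⟨⟨hx.1, hx.2.le⟩, fun _ => hx.2.ge⟩,
      fun hx => ⟨hx.1.1, hx.1.2.antisymm (hx.2 hx.1.1)⟩⟩
  rw [Measure.volume_eq_prod]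
  refine Measure.measure_prod_null_of_ae_null hmeas (Eventually.of_forall fun q => ?_)
  refine ((Set.toFinite {√(2 * (E - M.V₂ q)), -√(2 * (E - M.V₂ q))}).subset ?_).measure_zero _
  rintro p ⟨-, hp⟩
  simp only [energy₂] at hp
  have : p ^ 2 = 2 * (E - M.V₂ q) := by linarith
  rw [← this, Real.sqrt_sq_eq_abs]
  rcases abs_choice p with h | h <;> simp [h]

/-- The action is left-continuous at every confined energy. -/
theorem exists_lt_action (hr : 1 ≤ r) {b h : ℝ} (hc : Confines M.D₂ M.V₂ h) (hh : 0 < h)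
    (hb0 : 0 ≤ b) (hb : b < M.action h) : ∃ E < h, b < M.action E := by
  set s : ℕ → Set (ℝ × ℝ) := fun n => M.sublevel (h - 1 / ((n : ℝ) + 1)) with hs
  have hmono : Monotone s := fun m n hmn => M.sublevel_mono <|
    sub_le_sub_left (one_div_le_one_div_of_le (by positivity) (by gcongr)) h
  have hvol : volume (M.sublevel h) ≤ volume (⋃ n, s n) := by
    have hsub : M.sublevel h ⊆
        (⋃ n, s n) ∪ {x : ℝ × ℝ | x.1 ∈ M.D₂ ∧ M.energy₂ x.1 x.2 = h} := by
      rintro x ⟨hx, hxE⟩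
      rcases hxE.eq_or_lt with heq | hlt
      · exact .inr ⟨hx, heq⟩
      · obtain ⟨n, hn⟩ := exists_nat_one_div_lt (sub_pos.2 hlt)
        exact .inl (mem_iUnion.2 ⟨n, hx, by linarith⟩)
    refine (measure_mono hsub).trans ((measure_union_le _ _).trans ?_)
    rw [M.volume_level_eq_zero, add_zero]
  have hb' : ENNReal.ofReal (b * (2 * Real.pi)) < volume (⋃ n, s n) := by
    refine lt_of_lt_of_le ?_ hvol
    rw [ENNReal.ofReal_lt_iff_lt_toReal (by positivity)
      (M.volume_sublevel_lt_top hr hc hh le_rfl).ne]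
    rwa [action_eq, lt_div_iff₀ (by positivity)] at hb
  obtain ⟨n, hn⟩ := ((tendsto_measure_iUnion_atTop hmono).eventually (lt_mem_nhds hb')).exists
  have hlt : h - 1 / ((n : ℝ) + 1) < h := sub_lt_self _ (by positivity)
  refine ⟨_, hlt, ?_⟩
  rw [action_eq, lt_div_iff₀ (by positivity)]
  exact (ENNReal.ofReal_lt_iff_lt_toReal (by positivity)
    (M.volume_sublevel_lt_top hr hc hh hlt.le).ne).1 hn

/-! ### The angle of the vertical oscillator -/

/-- On an energy level the angle is the scaled travel time `S`, up to the sign of `-p₂`; it runs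
from `π` at the minimum `u` of `q₂` down to `0` at the maximum `v`. -/
theorem exists_angle_eq (hr : 1 ≤ r) {E h : ℝ} (hc : Confines M.D₂ M.V₂ h) (hE : 0 < E)
    (hEh : E ≤ h) : ∃ u v : ℝ, u ∈ M.D₂ ∧ v ∈ M.D₂ ∧ u < 0 ∧ 0 < v ∧ M.V₂ u = E ∧ M.V₂ v = E ∧
      {q | q ∈ M.D₂ ∧ M.V₂ q ≤ E} = Icc u v ∧
      ∃ S : ℝ → ℝ, StrictAntiOn S (Icc u v) ∧ S u = Real.pi ∧ S v = 0 ∧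
        ∀ q p, M.energy₂ q p = E →
          M.angle q p = (((if p ≤ 0 then 1 else -1) * S q : ℝ) : Real.Angle) := by
  have W := M.isPotentialWell₂ hr
  obtain ⟨u, v, hu, hv, hu0, hv0, huE, hvE, hset⟩ := W.exists_turning_points hc hE hEh
  refine ⟨u, v, hu, hv, hu0, hv0, huE, hvE, hset, ?_⟩
  have huv : u ≤ v := (hu0.trans hv0).le
  have hmax : M.q₂max E = v := by rw [q₂max, hset, csSup_Icc huv]
  have hmin : M.q₂min E = u := by rw [q₂min, hset, csInf_Icc huv]
  have hint := W.intervalIntegrable_inv_speed hu hv hu0 hv0 huE hvE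
  have hsubint {x y : ℝ} (hx : x ∈ Icc u v) (hy : y ∈ Icc u v) :
      IntervalIntegrable (fun s => 1 / √(2 * (E - M.V₂ s))) volume x y :=
    hint.mono_set (by rw [uIcc_of_le huv]; exact uIcc_subset_Icc hx hy)
  have hpos : ∀ s ∈ Ioo u v, 0 < 1 / √(2 * (E - M.V₂ s)) := fun s hs => by
    have hsE : s ∈ {q | q ∈ M.D₂ ∧ M.V₂ q ≤ E} := hset ▸ Ioo_subset_Icc_self hs
    have hne : M.V₂ s ≠ E := fun heq => by
      rcases W.eq_turning_point hu hv hu0 hv0 (huE.trans hvE.symm) hsE.1 (heq.trans hvE.symm)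
        with rfl | rfl
      exacts [hs.1.false, hs.2.false]
    have := lt_of_le_of_ne hsE.2 hne
    exact one_div_pos.2 (Real.sqrt_pos.2 (by linarith))
  have hanti : StrictAntiOn (M.travelTime₂ E) (Icc u v) := fun x hx y hy hxy => by
    have hadd := intervalIntegral.integral_add_adjacent_intervals (hsubint hx hy)
      (hsubint hy (right_mem_Icc.2 huv))
    have hp := intervalIntegral.intervalIntegral_pos_of_pos_on (hsubint hx hy)
      (fun s hs => hpos s ⟨hx.1.trans_lt hs.1, hs.2.trans_le hy.2⟩) hxy
    simp only [travelTime₂, hmax]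
    linarith
  have hTv : M.travelTime₂ E v = 0 := by simp [travelTime₂, hmax]
  have hTu : M.period₂ E = 2 * M.travelTime₂ E u := by simp [travelTime₂, period₂, hmax, hmin]
  have hTu0 : 0 < M.travelTime₂ E u :=
    hTv ▸ hanti (left_mem_Icc.2 huv) (right_mem_Icc.2 huv) (hu0.trans hv0)
  have hk : 0 < 2 * Real.pi / M.period₂ E := by rw [hTu]; positivity
  refine ⟨fun q => 2 * Real.pi / M.period₂ E * M.travelTime₂ E q,
    fun x hx y hy hxy => mul_lt_mul_of_pos_left (hanti hx hy hxy) hk, ?_, by simp [hTv], ?_⟩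
  · simp only [hTu]
    field_simp
  · rintro q p rfl
    rfl

theorem angle_neg (hr : 1 ≤ r) {h q p : ℝ} (hc : Confines M.D₂ M.V₂ h) (hq : q ∈ M.D₂)
    (hE : 0 < M.energy₂ q p) (hEh : M.energy₂ q p ≤ h) : M.angle q (-p) = -M.angle q p := by
  obtain ⟨u, v, hu, hv, hu0, hv0, huE, hvE, -, S, -, hSu, hSv, hS⟩ :=
    M.exists_angle_eq hr hc hE hEh
  rw [hS q p rfl, hS q (-p) (by simp [energy₂])]
  rcases lt_trichotomy p 0 with hp | rfl | hp
  · simp [hp.le, hp.not_ge]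
  · have hqE : M.V₂ q = M.V₂ v := by simp [hvE, energy₂]
    rcases (M.isPotentialWell₂ hr).eq_turning_point hu hv hu0 hv0 (huE.trans hvE.symm) hq hqE
      with rfl | rfl
    · simp [hSu]
    · simp [hSv]
  · simp [hp.le, hp.not_ge]

theorem eq_of_angle_eq (hr : 1 ≤ r) {h q p q' p' : ℝ} (hc : Confines M.D₂ M.V₂ h)
    (hq : q ∈ M.D₂) (hq' : q' ∈ M.D₂) (hE : 0 < M.energy₂ q p) (hEh : M.energy₂ q p ≤ h)
    (hEE : M.energy₂ q' p' = M.energy₂ q p) (hang : M.angle q p = M.angle q' p') :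
    q = q' ∧ p = p' := by
  obtain ⟨u, v, hu, hv, hu0, hv0, huE, hvE, hset, S, hSanti, hSu, hSv, hS⟩ :=
    M.exists_angle_eq hr hc hE hEh
  have huv : u ≤ v := (hu0.trans hv0).le
  have hum : u ∈ Icc u v := left_mem_Icc.2 huv
  have hvm : v ∈ Icc u v := right_mem_Icc.2 huv
  have key : ∀ x y, x ∈ M.D₂ → M.energy₂ x y = M.energy₂ q p → x ∈ Icc u v ∧
      (M.angle x y).toReal = (if y ≤ 0 then 1 else -1) * S x ∧
      (0 < y → 0 < S x) ∧ 0 ≤ S x := by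
    intro x y hx hxy
    have hxm : x ∈ Icc u v := hset ▸ ⟨hx, by rw [← hxy, energy₂]; nlinarith [sq_nonneg y]⟩
    have hS0 : 0 ≤ S x := hSv ▸ hSanti.antitoneOn hxm hvm hxm.2
    have hSpi : S x ≤ Real.pi := hSu ▸ hSanti.antitoneOn hum hxm hxm.1
    have hy : 0 < y → 0 < S x ∧ S x < Real.pi := fun hy => by
      have hVx : M.V₂ x < M.energy₂ q p := by rw [← hxy, energy₂]; nlinarith [sq_pos_of_pos hy]
      have hxu : u ≠ x := by rintro rfl; exact hVx.ne huE
      have hxv : x ≠ v := by rintro rfl; exact hVx.ne hvE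
      exact ⟨hSv ▸ hSanti hxm hvm (hxm.2.lt_of_ne hxv),
        hSu ▸ hSanti hum hxm (hxm.1.lt_of_ne hxu)⟩
    refine ⟨hxm, ?_, fun h => (hy h).1, hS0⟩
    rw [hS x y hxy, Real.Angle.toReal_coe_eq_self_iff]
    split_ifs with h
    · constructor <;> linarith [Real.pi_pos]
    · have := hy (not_le.1 h)
      constructor <;> linarith
  obtain ⟨hm, ht, hp, h0⟩ := key q p hq rfl
  obtain ⟨hm', ht', hp', h0'⟩ := key q' p' hq' hEE
  rw [hang, ht'] at ht
  have hqq : S q = S q' ∧ (p ≤ 0 ↔ p' ≤ 0) := by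
    split_ifs at ht with h1 h2 h2
    · exact ⟨by linarith, by simp [h1, h2]⟩
    · linarith [hp (not_le.1 h2)]
    · linarith [hp' (not_le.1 h1)]
    · exact ⟨by linarith, by simp [h1, h2]⟩
  obtain rfl : q = q' := hSanti.injOn hm hm' hqq.1
  refine ⟨rfl, ?_⟩
  have hsq : p ^ 2 = p' ^ 2 := by simp only [energy₂] at hEE; linarith
  rcases sq_eq_sq_iff_eq_or_eq_neg.1 hsq with h | h
  · exact h
  · have := hqq.2
    rcases le_or_gt p 0 with h1 | h1
    · have := this.1 h1
      linarith
    · have := mt this.2 (not_le.2 h1)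
      linarith

end StepSystem

/-- A relation that is functional in both directions is the graph of a partial equivalence. -/
theorem exists_pequiv_of_rel {α β : Type*} {R : α → β → Prop}
    (hfun : ∀ x y y', R x y → R x y' → y = y') (hinj : ∀ x x' y, R x y → R x' y → x = x') :
    ∃ F : α ≃. β, ∀ x y, y ∈ F x ↔ R x y := by
  classical
  refine ⟨⟨fun x => if h : ∃ y, R x y then some h.choose else none,
    fun y => if h : ∃ x, R x y then some h.choose else none, fun x y => ?_⟩, fun x y => ?_⟩
  · constructor
    · intro h
      split_ifs at h with hx
      have hxy : R x y := Option.some.inj h ▸ hx.choose_spec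
      have hy : ∃ y, R x y := ⟨y, hxy⟩
      rw [dif_pos hy, hfun x _ _ hy.choose_spec hxy]
    · intro h
      split_ifs at h with hx
      have hxy : R x y := Option.some.inj h ▸ hx.choose_spec
      have hy : ∃ x, R x y := ⟨x, hxy⟩
      rw [dif_pos hy, hinj _ _ _ hy.choose_spec hxy]
  · change (if h : ∃ y, R x y then some h.choose else none) = some y ↔ R x y
    constructor
    · intro h
      split_ifs at h with hx
      exact Option.some.inj h ▸ hx.choose_spec
    · intro hxy
      have hy : ∃ y, R x y := ⟨y, hxy⟩
      rw [dif_pos hy, hfun x _ _ hy.choose_spec hxy]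

namespace StepSystem

variable {r : ℕ} (M : StepSystem r)

/-! ### The section as a graph over the vertical phase plane -/

theorem exists_coupling_bound (hr : 1 ≤ r) :
    ∃ C, 0 ≤ C ∧ ∀ q ∈ M.D₁ ×ˢ M.D₂, |M.Vc q| ≤ C ∧ |fderiv ℝ M.Vc q (1, 0)| ≤ C := by
  obtain ⟨C₀, h₀⟩ := M.bounded_Vc 0 r.zero_le
  obtain ⟨C₁, h₁⟩ := M.bounded_Vc 1 hr
  refine ⟨max 0 (max C₀ C₁), le_max_left _ _, fun q hq => ⟨?_, ?_⟩⟩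
  · have := h₀ q hq
    rw [norm_iteratedFDeriv_zero, Real.norm_eq_abs] at this
    exact this.trans ((le_max_left _ _).trans (le_max_right _ _))
  · have := h₁ q hq
    rw [norm_iteratedFDeriv_one] at this
    refine le_trans ?_ (this.trans ((le_max_right _ _).trans (le_max_right _ _)))
    simpa using (fderiv ℝ M.Vc q).le_opNorm ((1 : ℝ), (0 : ℝ))

theorem hasDerivAt_horizontal (hr : 1 ≤ r) (ε : ℝ) {x y : ℝ} (hx : x ∈ M.D₁) (hy : y ∈ M.D₂) :
    HasDerivAt (fun x => M.V₁ x + ε * M.Vc (x, y))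
      (deriv M.V₁ x + ε * fderiv ℝ M.Vc (x, y) (1, 0)) x := by
  have hd : DifferentiableAt ℝ M.Vc (x, y) :=
    (M.contDiffOn_Vc.contDiffAt ((M.isOpen_D₁.prod M.isOpen_D₂).mem_nhds ⟨hx, hy⟩)).differentiableAt
      (by exact_mod_cast (by omega : r ≠ 0))
  have := hd.hasFDerivAt.comp_hasDerivAt x ((hasDerivAt_id x).prodMk (hasDerivAt_const x y))
  exact ((M.isPotentialWell₁ hr).differentiableAt hx).hasDerivAt.add (this.const_mul ε)

/-- For small `ε`, the points of the section whose vertical energy stays away from `h` are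
determined by their vertical coordinates. -/
theorem exists_sect_unique (hr : 1 ≤ r) {h E₀ : ℝ} (hc : Confines M.D₁ M.V₁ h) (hE₀ : E₀ < h) :
    ∃ εc > 0, ∀ ε : ℝ, |ε| < εc → ∀ z ∈ M.sect h ε, ∀ z' ∈ M.sect h ε,
      z.1.2 = z'.1.2 → z.2.2 = z'.2.2 → M.energy₂ z.1.2 z.2.2 ≤ E₀ → z = z' := by
  have W := M.isPotentialWell₁ hr
  obtain ⟨⟨α, hα, hα0, hαh⟩, β, hβ, hβ0, hβh⟩ := hc
  obtain ⟨C, hC0, hC⟩ := M.exists_coupling_bound hr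
  have hsub : Icc α β ⊆ M.D₁ := W.ordConnected.out hα hβ
  set δ := (h - E₀) / 2 with hδ
  have hδ0 : 0 < δ := by linarith
  have hK : IsCompact (Icc α β ∩ M.V₁ ⁻¹' Ici δ) :=
    isCompact_Icc.of_isClosed_subset
      ((W.continuousOn.mono hsub).preimage_isClosed_of_isClosed isClosed_Icc isClosed_Ici)
      inter_subset_left
  obtain ⟨c, hc0, hcK⟩ := hK.exists_forall_le' (f := fun q => |deriv M.V₁ q|) (a := 0)
    (W.continuousOn_deriv.mono (inter_subset_left.trans hsub)).abs fun q hq => by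
      have hq0 : q ≠ 0 := by
        rintro rfl
        exact hδ0.not_ge (W.map_zero ▸ hq.2)
      exact abs_pos.2 (right_ne_zero_of_mul (W.mul_deriv_pos q (hsub hq.1) hq0).ne')
  set m := min (min δ c) (min (M.V₁ α - h) (M.V₁ β - h)) with hm
  have hm0 : 0 < m := lt_min (lt_min hδ0 hc0) (lt_min (by linarith) (by linarith))
  have hmδ : m ≤ δ := (min_le_left _ _).trans (min_le_left _ _)
  have hmc : m ≤ c := (min_le_left _ _).trans (min_le_right _ _)
  have hmα : m ≤ M.V₁ α - h := (min_le_right _ _).trans (min_le_left _ _)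
  have hmβ : m ≤ M.V₁ β - h := (min_le_right _ _).trans (min_le_right _ _)
  refine ⟨m / (C + 1), by positivity, fun ε hε => ?_⟩
  have hεC : |ε| * C < m := by
    rw [lt_div_iff₀ (by positivity)] at hε
    nlinarith [abs_nonneg ε]
  have hsmall : ∀ y : ℝ, |y| ≤ C → |ε * y| < m := fun y hy => by
    rw [abs_mul]
    exact (mul_le_mul_of_nonneg_left hy (abs_nonneg ε)).trans_lt hεC
  have key : ∀ z ∈ M.sect h ε, M.energy₂ z.1.2 z.2.2 ≤ E₀ →
      0 < z.1.1 ∧ z.1.1 ≤ β ∧ δ ≤ M.V₁ z.1.1 := by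
    rintro ⟨⟨q₁, q₂⟩, p₁, p₂⟩ ⟨⟨⟨hq₁, hq₂⟩, -⟩, rfl : p₁ = 0, hf, hH⟩ hE
    simp only [energy, force₁, energy₂] at hq₁ hq₂ hf hH hE ⊢
    have hVc := abs_lt.1 (hsmall _ (hC (q₁, q₂) ⟨hq₁, hq₂⟩).1)
    have hVd := abs_lt.1 (hsmall _ (hC (q₁, q₂) ⟨hq₁, hq₂⟩).2)
    have hV₂ := (M.isPotentialWell₂ hr).nonneg hq₂
    have h1 : δ ≤ M.V₁ q₁ := by linarith
    have h2 : M.V₁ q₁ ≤ M.V₁ α := by nlinarith [sq_nonneg p₂]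
    have h3 : M.V₁ q₁ ≤ M.V₁ β := by nlinarith [sq_nonneg p₂]
    have hα' : α ≤ q₁ := by
      rcases le_total 0 q₁ with hs | hs
      · linarith
      · exact (W.le_iff_of_nonpos hα hα0.le hq₁ hs).1 h2
    have hβ' : q₁ ≤ β := by
      rcases le_total 0 q₁ with hs | hs
      · exact (W.le_iff_of_nonneg hβ hβ0.le hq₁ hs).1 h3
      · linarith
    refine ⟨?_, hβ', h1⟩
    have hcd : c ≤ |deriv M.V₁ q₁| := hcK q₁ ⟨⟨hα', hβ'⟩, h1⟩
    have hd : 0 < deriv M.V₁ q₁ := by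
      rcases le_abs.1 hcd with hd | hd <;> linarith
    have hq0 : q₁ ≠ 0 := by
      rintro rfl
      linarith [W.map_zero]
    exact pos_of_mul_pos_left (W.mul_deriv_pos q₁ hq₁ hq0) hd.le
  have key2 : ∀ z ∈ M.sect h ε, ∀ z' ∈ M.sect h ε, z.1.2 = z'.1.2 → z.2.2 = z'.2.2 →
      M.energy₂ z.1.2 z.2.2 ≤ E₀ → ¬ z.1.1 < z'.1.1 := by
    intro z hz z' hz' hq hp hE hlt
    obtain ⟨h0, hβ₁, hV⟩ := key z hz hE
    obtain ⟨h0', hβ', -⟩ := key z' hz' (hq ▸ hp ▸ hE)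
    obtain ⟨⟨⟨hz₁, hz₂⟩, -⟩, hp₁, -, hH⟩ := hz
    obtain ⟨-, hp₁', -, hH'⟩ := hz'
    have hin : Icc z.1.1 z'.1.1 ⊆ M.D₁ := fun x hx =>
      hsub ⟨by linarith [hx.1], by linarith [hx.2]⟩
    have hd : ∀ x ∈ Icc z.1.1 z'.1.1, HasDerivAt (fun x => M.V₁ x + ε * M.Vc (x, z.1.2))
        (deriv M.V₁ x + ε * fderiv ℝ M.Vc (x, z.1.2) (1, 0)) x :=
      fun x hx => M.hasDerivAt_horizontal hr ε (hin hx) hz₂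
    have hmono : StrictMonoOn (fun x => M.V₁ x + ε * M.Vc (x, z.1.2)) (Icc z.1.1 z'.1.1) := by
      refine strictMonoOn_of_deriv_pos (convex_Icc _ _)
        (fun x hx => (hd x hx).continuousAt.continuousWithinAt) fun x hx => ?_
      have hx := interior_subset hx
      have hx0 : 0 < x := h0.trans_le hx.1
      rw [(hd x hx).deriv]
      have hVd := abs_lt.1 (hsmall _ (hC (x, z.1.2) ⟨hin hx, hz₂⟩).2)
      have hVx : δ ≤ M.V₁ x :=
        hV.trans ((W.le_iff_of_nonneg (hin hx) hx0.le hz₁ h0.le).2 hx.1)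
      have hcd : c ≤ |deriv M.V₁ x| :=
        hcK x ⟨⟨by linarith, hx.2.trans hβ'⟩, hVx⟩
      rw [abs_of_pos (pos_of_mul_pos_right (W.mul_deriv_pos x (hin hx) hx0.ne') hx0.le)] at hcd
      linarith
    have := hmono (left_mem_Icc.2 hlt.le) (right_mem_Icc.2 hlt.le) hlt
    obtain ⟨⟨q₁, q₂⟩, p₁, p₂⟩ := z
    obtain ⟨⟨q₁', q₂'⟩, p₁', p₂'⟩ := z'
    simp only [energy] at hq hp hp₁ hp₁' hH hH' this
    subst hq hp hp₁ hp₁'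
    linarith
  intro z hz z' hz' hq hp hE
  have h1 : z.1.1 = z'.1.1 := le_antisymm
    (not_lt.1 (key2 z' hz' z hz hq.symm hp.symm (hq ▸ hp ▸ hE)))
    (not_lt.1 (key2 z hz z' hz' hq hp hE))
  exact Prod.ext (Prod.ext h1 hq) (Prod.ext (hz.2.1.trans hz'.2.1.symm) hp)

/-! ### The return map and its reversing symmetry -/

theorem angleAction_timeReversal (hr : 1 ≤ r) {h : ℝ} (hc : Confines M.D₂ M.V₂ h) {z : Phase}
    (hz : z.1.2 ∈ M.D₂) (hE : 0 < M.energy₂ z.1.2 z.2.2) (hEh : M.energy₂ z.1.2 z.2.2 ≤ h) :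
    M.angleAction (timeReversal z) = (-(M.angleAction z).1, (M.angleAction z).2) := by
  have h1 := M.angle_neg hr hc hz hE hEh
  refine Prod.ext h1 ?_
  simp [angleAction, energy₂]

theorem mem_inNormal {h ε : ℝ} {F : Cylinder ≃. Cylinder} {u v : Cylinder} :
    v ∈ M.inNormal h ε F u ↔ (M.normal h ε).symm v ∈ F ((M.normal h ε).symm u) := by
  rw [inNormal, PEquiv.mem_trans]
  simp only [PEquiv.mem_trans, Equiv.toPEquiv_apply, Option.mem_some_iff]
  constructor
  · rintro ⟨w, ⟨x, rfl, hx⟩, rfl⟩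
    simpa using hx
  · intro hv
    exact ⟨_, ⟨_, rfl, hv⟩, by simp⟩

theorem epsF_neg (h ε : ℝ) (φ : Real.Angle) : M.epsF h ε (-φ) = -M.epsF h ε φ := by
  simp [epsF]

theorem reversor_involutive (h ε : ℝ) : Function.Involutive (M.reversor h ε) := fun u => by
  simp [reversor, epsF_neg]

theorem normal_symm_reversor (h ε : ℝ) (u : Cylinder) :
    (M.normal h ε).symm (M.reversor h ε u) =
      (-((M.normal h ε).symm u).1, ((M.normal h ε).symm u).2) := by
  simp only [normal, reversor, epsF, Equiv.coe_fn_symm_mk]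
  refine Prod.ext rfl ?_
  dsimp only
  ring

/-- A partial map that the reflection `(θ, I) ↦ (-θ, I)` conjugates to its inverse is, in the normal
coordinates, conjugated to its inverse by the reversor. -/
theorem inNormal_reversible {h ε : ℝ} {F : Cylinder ≃. Cylinder}
    (hF : ∀ x y : Cylinder, y ∈ F x → (-x.1, x.2) ∈ F (-y.1, y.2)) (u : Cylinder) :
    (M.inNormal h ε F u).map (M.reversor h ε) =
      (M.inNormal h ε F).symm (M.reversor h ε u) := by
  ext v
  rw [← Option.mem_def, ← Option.mem_def, PEquiv.mem_iff_mem, mem_inNormal,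
    normal_symm_reversor, Option.mem_map]
  constructor
  · rintro ⟨w, hw, rfl⟩
    rw [mem_inNormal] at hw
    rw [normal_symm_reversor]
    exact hF _ _ hw
  · intro hv
    refine ⟨M.reversor h ε v, ?_, M.reversor_involutive h ε v⟩
    rw [mem_inNormal, normal_symm_reversor]
    simpa using hF _ _ hv

end StepSystem

end

theorem theorem3p3 (r : ℕ) (hr : 4 < r) (M : StepSystem r) (h : ℝ)
    (hh : M.V₁ M.q₁w + M.V₂ M.q₂w < h)
    (hc₁ : Confines M.D₁ M.V₁ h) (hc₂ : Confines M.D₂ M.V₂ h)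
    (a b : ℝ) (ha : 0 < a) (hab : a < b) (hb : b < M.action h) :
    ∃ εc > 0, ∀ ε : ℝ, |ε| < εc →
      (∀ φ : Real.Angle, M.epsF h ε (-φ) = -M.epsF h ε φ) ∧
      ∃ F : Cylinder ≃. Cylinder,
        (∀ x y : Cylinder, y ∈ F x ↔
          x.2 ∈ Set.Ioo a b ∧ y.2 ∈ Set.Ioo a b ∧ M.ReturnAA h ε x y) ∧
        ∀ u : Cylinder, (M.inNormal h ε F u).map (M.reversor h ε) =
          (M.inNormal h ε F).symm (M.reversor h ε u) := by
  have hr1 : 1 ≤ r := by omega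
  have hr2 : 2 ≤ r := by omega
  have hh0 : 0 < h := by
    have h1 := (M.isPotentialWell₁ hr1).nonneg M.q₁w_mem
    have h2 := (M.isPotentialWell₂ hr1).nonneg M.q₂w_mem
    linarith
  obtain ⟨E₀, hE₀, hbE₀⟩ := M.exists_lt_action hr1 hc₂ hh0 (ha.trans hab).le hb
  obtain ⟨εc, hεc, huniq⟩ := M.exists_sect_unique hr1 hc₁ hE₀
  refine ⟨εc, hεc, fun ε hε => ⟨M.epsF_neg h ε, ?_⟩⟩
  have henergy : ∀ z : Phase, (M.angleAction z).2 ∈ Set.Ioo a b →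
      0 < M.energy₂ z.1.2 z.2.2 ∧ M.energy₂ z.1.2 z.2.2 ≤ E₀ := fun z hz =>
    ⟨M.pos_of_action_pos hr1 (ha.trans hz.1),
      (M.lt_of_action_lt hr1 hc₂ hh0 (ha.trans hz.1) (hz.2.trans hbE₀)).le⟩
  have hcoord : ∀ z ∈ M.sect h ε, ∀ z' ∈ M.sect h ε, (M.angleAction z).2 ∈ Set.Ioo a b →
      M.angleAction z = M.angleAction z' → z = z' := by
    intro z hz z' hz' hI heq
    obtain ⟨h1, h2⟩ := henergy z hI
    obtain ⟨h1', h2'⟩ := henergy z' (heq ▸ hI)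
    have hEE : M.energy₂ z.1.2 z.2.2 = M.energy₂ z'.1.2 z'.2.2 :=
      (M.action_strictMonoOn hr1 hc₂).injOn ⟨h1.le, h2.trans hE₀.le⟩ ⟨h1'.le, h2'.trans hE₀.le⟩
        (congrArg Prod.snd heq)
    obtain ⟨hq, hp⟩ := M.eq_of_angle_eq hr1 hc₂ hz.1.1.2 hz'.1.1.2 h1 (h2.trans hE₀.le) hEE.symm
      (congrArg Prod.fst heq)
    exact huniq ε hε z hz z' hz' hq hp h2
  have hfun : ∀ x y y' : Cylinder,
      (x.2 ∈ Set.Ioo a b ∧ y.2 ∈ Set.Ioo a b ∧ M.ReturnAA h ε x y) →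
      (x.2 ∈ Set.Ioo a b ∧ y'.2 ∈ Set.Ioo a b ∧ M.ReturnAA h ε x y') → y = y' := by
    rintro x y y' ⟨hx, -, z, w, hz, rfl, rfl⟩ ⟨-, -, z', w', hz', hzx, rfl⟩
    obtain rfl := hcoord z hz.1 z' hz'.1 hx hzx.symm
    rw [hz.2.2.unique hr2 hz'.2.2 hz.2.1 hz'.2.1]
  have hrev : ∀ x y : Cylinder,
      (x.2 ∈ Set.Ioo a b ∧ y.2 ∈ Set.Ioo a b ∧ M.ReturnAA h ε x y) →
      (y.2 ∈ Set.Ioo a b ∧ x.2 ∈ Set.Ioo a b ∧ M.ReturnAA h ε (-y.1, y.2) (-x.1, x.2)) := by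
    rintro x y ⟨hx, hy, z, w, hz, rfl, rfl⟩
    obtain ⟨h1, h2⟩ := henergy z hx
    obtain ⟨h1', h2'⟩ := henergy w hy
    exact ⟨hy, hx, _, _, hz.timeReversal,
      M.angleAction_timeReversal hr1 hc₂ hz.2.1.1.1.2 h1' (h2'.trans hE₀.le),
      M.angleAction_timeReversal hr1 hc₂ hz.1.1.1.2 h1 (h2.trans hE₀.le)⟩
  obtain ⟨F, hF⟩ := exists_pequiv_of_rel hfun fun x x' y hx hx' => by
    have := hfun (-y.1, y.2) (-x.1, x.2) (-x'.1, x'.2) (hrev x y hx) (hrev x' y hx')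
    rw [Prod.mk.injEq, neg_inj] at this
    exact Prod.ext this.1 this.2
  exact ⟨F, hF, M.inNormal_reversible fun x y hxy => (hF _ _).2 (hrev x y ((hF x y).1 hxy))⟩
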